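/- Let $p$ be a prime, $N\in\{0,1,2,\dots\}\cup\{\infty\}$, $\Lambda_N=\{x\in\mathbb{Q}_p:|x|_p\le p^N\}$ ($\Lambda_\infty=\mathbb{Q}_p$), and let $\chi$ be the Haar measure on $\mathbb{Q}_p$ with $\chi(\mathbb{Z}_p)=1$, regarded as an outer measure on all subsets. For $l\in\mathbb{Q}_p$, $n\in\mathbb{Z}$ put $B_l^n=\{x\in\Lambda_N:|x-l|_p\le p^{-n}\}$. *Distance of maps.* For functions $f,g:I\to[0,\infty]$ and filters $\mathcal F,\mathcal G$ on $I$, let $\ell(f_{\mathcal F},g_{\mathcal G})=\inf\{r\in[0,\infty):\exists U\in\mathcal G\ \forall x\in U\ f(x)\le r\,g(x)\}$ if $\mathcal F\subseteq\mathcal G$, and $=\infty$ otherwise; let $\mathfrak a(f_{\mathcal F},g_{\mathcal G})=\max\bigl(0,\ln\max(\ell(f_{\mathcal F},g_{\mathcal G}),\ell(g_{\mathcal G},f_{\mathcal F}))\bigr)$. For maps $\Phi_1,\Phi_2$ from a set $X$ to $\mathbb{R}^d$, $\mathfrak a(\Phi_1,\Phi_2)$ is this quantity for the pseudometrics $\rho_i(x,y)=|\Phi_i(x)-\Phi_i(y)|$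 on $I=X\times X$, each taken with the filter generated by the sets $\{\rho_i<\varepsilon\}$, $\varepsilon>0$. *Automodel maps.* A continuous map $\Upsilon:\Lambda_N\to\mathbb{R}^d$ is automodel if for some integer $m\ge 0$ and for all $n\in\mathbb{Z}$, $l\in\Lambda_N$ there are isometries $E_{l,j,n}$ of $\mathbb{R}^d$ ($0\le j<p^m$) with $$\Upsilon(B_l^n)=\bigcup_{j=0}^{p^m-1}E_{l,j,n}\bigl(\Upsilon(B_{p^nj}^{n+m})\bigr),$$ where the $p^m$ sets on the right are clusters of level $n+m$, that is, $E_{l,j,n}(\Upsilon(B_{p^nj}^{n+m}))=\Upsilon(B_{c_j}^{n+m})$ with pairwise disjoint balls $B_{c_0}^{n+m},\dots,B_{c_{p^m-1}}^{n+m}$. A map $\Upsilon:\Lambda_N\to\mathbb{R}^d$ is quasi-automodel if $\mathfrak a(\Upsilon_k,\Upsilon)\to0$ for some sequence of automodel maps $\Upsilon_k:\Lambda_N\to\mathbb{R}^d$. *Measures.* For $D\ge0$, $\mathcal S^D$ is the set of functions $\zeta:[0,\infty]\to[0,\infty]$ for which there is a nondecreasing $\varsigma:[0,\infty]\to[0,\infty]$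 with $\varsigma(r)>0$ for $r>0$ and $\lim_{r\to0+}\varsigma(\lambda r)/\varsigma(r)=\lambda^D$ for all $\lambda>0$, such that $\ell(\zeta,\varsigma)\le1$ and $\ell(\varsigma,\zeta)\le1$ for the filter of neighbourhoods of $0$. For $A\subseteq\mathbb{R}^d$, $$k_\zeta(A)=\sup_{\delta>0}\inf\Bigl\{\sum_i\zeta(\operatorname{diam}S_i): \{S_i\}\text{ a countable cover of }A,\ \operatorname{diam}S_i\le\delta\Bigr\}.$$ **Proposition 3.** Let $\Upsilon:\Lambda_N\to\mathbb{R}^d$ be quasi-automodel, let $D\ge0$, and let $\zeta\in\mathcal S^D$ be such that $k_\zeta(\Upsilon(\mathbb{Z}_p))<\infty$ and $k_\zeta(\Upsilon(B_l^n)\cap\Upsilon(B_{l'}^{n'}))=0$ whenever $B_l^n\cap B_{l'}^{n'}=\emptyset$. Then for every $A\subseteq\mathbb{R}^d$ $$k_\zeta(A\cap\Upsilon(\Lambda_N))=k_\zeta(\Upsilon(\mathbb{Z}_p))\,\chi(\Upsilon^{-1}(A)).$$ Consequently, if $k_\zeta(\Upsilon(\mathbb{Z}_p))\ne0$, the normalized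 fractal measure $k_\zeta(\Upsilon(\mathbb{Z}_p))^{-1}k_\zeta(\,\cdot\,\cap\Upsilon(\Lambda_N))$ is the image $\chi(\Upsilon^{-1}(\cdot))$ of the Haar measure. -/

import Mathlib

open MeasureTheory Filter Topology
open scoped ENNReal NNReal

noncomputable section

namespace PadicFractal

/-- `ℓ(f_F, g_G)` for `[0, ∞]`-valued functions `f`, `g` with filters `F`, `G`: the infimum of the
finite `r` such that `f ≤ r g` on some member of `G`, provided every member of `F` is a member
of `G` (in Mathlib's order on filters: `G ≤ F`), and `∞` otherwise. -/
def ell {I : Type*} (f : I → ℝ≥0∞) (F : Filter I) (g : I → ℝ≥0∞) (G : Filter I) : ℝ≥0∞ :=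
  open Classical in
  if G ≤ F then ⨅ (r : ℝ≥0) (_ : ∀ᶠ x in G, f x ≤ r * g x), (r : ℝ≥0∞) else ∞

/-- The pseudometric `ln max (ℓ(f_F, g_G), ℓ(g_G, f_F))` with values in `[0, ∞]`. The truncation at
`0` matters only if both quantities `ℓ` vanish (`f` and `g` are degenerate near the filter). -/
def logDist {I : Type*} (f : I → ℝ≥0∞) (F : Filter I) (g : I → ℝ≥0∞) (G : Filter I) : EReal :=
  max 0 (ENNReal.log (max (ell f F g G) (ell g G f F)))

/-- The pseudometric on `X` induced by a map `Φ` into a metric space. -/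
def pullDist {X M : Type*} [PseudoEMetricSpace M] (Φ : X → M) (q : X × X) : ℝ≥0∞ :=
  edist (Φ q.1) (Φ q.2)

/-- The filter on `X × X` whose base are the preimages of the neighbourhoods of `0` under the
induced pseudometric. -/
def pullFilter {X M : Type*} [PseudoEMetricSpace M] (Φ : X → M) : Filter (X × X) :=
  comap (pullDist Φ) (𝓝 0)

/-- The distance between two maps from `X` into metric spaces. -/
def mapDist {X M₁ M₂ : Type*} [PseudoEMetricSpace M₁] [PseudoEMetricSpace M₂]
    (Φ₁ : X → M₁) (Φ₂ : X → M₂) : EReal :=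
  logDist (pullDist Φ₁) (pullFilter Φ₁) (pullDist Φ₂) (pullFilter Φ₂)

/-- The class `S^D`: gauge functions `ζ` that are equivalent at `0` (`ℓ ≤ 1` in both directions)
to a nondecreasing function `ς`, positive off `0`, with `ς (c r) / ς r → c ^ D` as `r → 0`. -/
def IsScaleGauge (D : ℝ) (ζ : ℝ≥0∞ → ℝ≥0∞) : Prop :=
  ∃ ς : ℝ≥0∞ → ℝ≥0∞, Monotone ς ∧ (∀ r, 0 < r → 0 < ς r) ∧
    (∀ c : ℝ≥0, 0 < c →
      Tendsto (fun r : ℝ≥0∞ => ς (c * r) / ς r) (𝓝[>] 0) (𝓝 ((c : ℝ≥0∞) ^ D))) ∧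
    ell ζ (𝓝 0) ς (𝓝 0) ≤ 1 ∧ ell ς (𝓝 0) ζ (𝓝 0) ≤ 1

/-- The measure `k_ζ` given by the Carathéodory construction: the supremum over `δ > 0` of the
infimum of `∑ ζ (diam Sᵢ)` over the countable covers by sets `Sᵢ` of diameter at most `δ`. It is
an outer measure, defined on all subsets. -/
def kMeasure {X : Type*} [EMetricSpace X] (ζ : ℝ≥0∞ → ℝ≥0∞) : OuterMeasure X :=
  OuterMeasure.mkMetric ζ

variable (p : ℕ) [Fact p.Prime]

/-- `Λ_N = {x ∈ ℚ_p : |x| ≤ p ^ N}`, with `Λ_∞ = ℚ_p`. -/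
def Lam (N : ℕ∞) : Set ℚ_[p] := {x | ∀ k : ℕ, N = k → ‖x‖ ≤ (p : ℝ) ^ k}

variable {p} in
/-- The ball `B_l^n = {x ∈ Λ_N : |x - l| ≤ p ^ (-n)}` in `Λ_N`. -/
def cball {N : ℕ∞} (l : ℚ_[p]) (n : ℤ) : Set (Lam p N) :=
  {x | ‖(x : ℚ_[p]) - l‖ ≤ (p : ℝ) ^ (-n)}

/-- The ring of `p`-adic integers, as a subset of `Λ_N`. -/
def intSet (N : ℕ∞) : Set (Lam p N) := {x | ‖(x : ℚ_[p])‖ ≤ 1}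

/-- The ring of `p`-adic integers as a compact set with nonempty interior. -/
def intCompact : TopologicalSpace.PositiveCompacts ℚ_[p] where
  carrier := Metric.closedBall 0 1
  isCompact' := isCompact_closedBall 0 1
  interior_nonempty' :=
    ⟨0, Metric.ball_subset_interior_closedBall (Metric.mem_ball_self one_pos)⟩

/-- The Haar measure on `ℚ_p` normalized to give the `p`-adic integers measure `1`. -/
def haarQp [MeasurableSpace ℚ_[p]] [BorelSpace ℚ_[p]] : Measure ℚ_[p] :=
  Measure.addHaarMeasure (intCompact p)

variable {p} {N : ℕ∞} {d : ℕ}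

/-- Automodel maps. For some `m`, the cluster `Υ(B_l^n)` of every ball is the union of `p ^ m`
isometric copies of the clusters `Υ(B_{p^n j}^{n+m})`, `0 ≤ j < p ^ m`, of the balls into which
`B_0^n` splits, and these copies are again clusters, of pairwise disjoint balls. -/
def IsAutomodel (Υ : Lam p N → EuclideanSpace ℝ (Fin d)) : Prop :=
  Continuous Υ ∧ ∃ m : ℕ, ∀ n : ℤ, ∀ l ∈ Lam p N,
    ∃ (E : Fin (p ^ m) → EuclideanSpace ℝ (Fin d) → EuclideanSpace ℝ (Fin d))
      (c : Fin (p ^ m) → ℚ_[p]),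
      (∀ j, Isometry (E j)) ∧
      Υ '' cball l n =
        ⋃ j : Fin (p ^ m), E j '' (Υ '' cball ((p : ℚ_[p]) ^ n * ((j : ℕ) : ℚ_[p])) (n + m)) ∧
      (∀ j, E j '' (Υ '' cball ((p : ℚ_[p]) ^ n * ((j : ℕ) : ℚ_[p])) (n + m)) =
        Υ '' cball (c j) (n + m)) ∧
      Pairwise fun i j => Disjoint (cball (N := N) (c i) (n + m)) (cball (c j) (n + m))

/-- Quasi-automodel maps: limits of automodel maps for the distance between maps. -/
def IsQuasiAutomodel (Υ : Lam p N → EuclideanSpace ℝ (Fin d)) : Prop :=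
  ∃ Υs : ℕ → Lam p N → EuclideanSpace ℝ (Fin d),
    (∀ k, IsAutomodel (Υs k)) ∧ Tendsto (fun k => mapDist (Υs k) Υ) atTop (𝓝 0)

end PadicFractal

end

namespace PadicFractal

/-! ### Distortion of `kMeasure` under locally expanding maps. -/

section Distortion

/-! Maps at small distance are locally bi-Lipschitz to each other with constant `L` near `1`, and a
gauge of order `D` then changes fractal measures by a factor of at most `L ^ D`
(`kMeasure_image_le`). For an automodel map, every cluster of level `n` is cut into isometric copies
of the same `p ^ m` pieces with null overlaps, so all clusters of one level have equal measure.
Comparing through the approximants and letting `L → 1` carries this to a quasi-automodel map.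
Splitting balls then gives `kMeasure = c · χ` on clusters, with `c` the measure of `Υ '' intSet p
N`.

For an arbitrary set `T ⊆ Λ_N`, covering by balls and outer regularity of `χ` give `kMeasure (Υ ''
T) ≤ c · χ T`. The reverse bound comes from complements: inside a large ball, where equality is
known and everything is finite, the upper bound on a complement is a lower bound on the set. A
measurable hull on the fractal side handles non-measurable `T`. The theorem is the case `T = Υ ⁻¹'
A`. -/

theorem eventually_le_of_ell_lt {I : Type*} {f g : I → ℝ≥0∞} {F G : Filter I} {L : ℝ≥0∞}
    (h : ell f F g G < L) : ∀ᶠ x in G, f x ≤ L * g x := by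
  unfold ell at h
  split_ifs at h with hle
  · simp only [iInf_lt_iff] at h
    obtain ⟨r, hr, hrL⟩ := h
    filter_upwards [hr] with x hx
    exact hx.trans (by gcongr)
  · exact absurd h not_top_lt

/-- A gauge of order `D` grows at most by a factor close to `L ^ D` when its argument is
multiplied by `L ≥ 1`. -/
theorem IsScaleGauge.eventually_le {D : ℝ} (hD : 0 ≤ D) {ζ : ℝ≥0∞ → ℝ≥0∞}
    (hζ : IsScaleGauge D ζ) {L : ℝ≥0} (hL : 1 ≤ L) {θ : ℝ≥0∞} (hθ : 1 < θ) :
    ∃ δ : ℝ≥0∞, 0 < δ ∧ ∀ t ≤ δ, ∀ s ≤ L * t, ζ s ≤ θ ^ 3 * (L : ℝ≥0∞) ^ D * ζ t := by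
  obtain ⟨ς, hmono, hpos, hlim, h1, h2⟩ := hζ
  have e1 : ∀ᶠ x in 𝓝 0, ζ x ≤ θ * ς x := eventually_le_of_ell_lt (h1.trans_lt hθ)
  have e2 : ∀ᶠ x in 𝓝 0, ς x ≤ θ * ζ x := eventually_le_of_ell_lt (h2.trans_lt hθ)
  have hL0 : (0 : ℝ≥0) < L := zero_lt_one.trans_le hL
  have hLD1 : 1 ≤ (L : ℝ≥0∞) ^ D := by
    simpa using ENNReal.rpow_le_rpow (show (1 : ℝ≥0∞) ≤ L by exact_mod_cast hL) hD
  have hLDtop : (L : ℝ≥0∞) ^ D ≠ ∞ := ENNReal.rpow_ne_top_of_nonneg hD ENNReal.coe_ne_top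
  have hLD0 : (L : ℝ≥0∞) ^ D ≠ 0 := (zero_lt_one.trans_le hLD1).ne'
  have e3 : ∀ᶠ x in 𝓝[>] (0 : ℝ≥0∞), ς (L * x) ≤ θ * (L : ℝ≥0∞) ^ D * ς x := by
    have hlt : (L : ℝ≥0∞) ^ D < θ * (L : ℝ≥0∞) ^ D := by
      conv_lhs => rw [← one_mul ((L : ℝ≥0∞) ^ D)]
      exact ENNReal.mul_lt_mul_left hLD0 hLDtop hθ
    filter_upwards [(hlim L hL0).eventually (gt_mem_nhds hlt), self_mem_nhdsWithin] with x hx hx0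
    -- Division by `∞` gives `0`, so here the ratio says nothing; but then the right side is `∞`.
    rcases eq_or_ne (ς x) ∞ with htop | htop
    · rw [htop, ENNReal.mul_top (hlt.ne_bot)]
      exact le_top
    · exact (ENNReal.div_le_iff (hpos x hx0).ne' htop).1 hx.le
  have e4 : ∀ᶠ x in 𝓝 (0 : ℝ≥0∞), ς (L * x) ≤ θ * (L : ℝ≥0∞) ^ D * ς x := by
    rw [eventually_nhdsWithin_iff] at e3
    filter_upwards [e3] with x hx
    -- The limit ignores `0`, where the bound holds because its factor is at least `1`.
    rcases eq_or_ne x 0 with rfl | hx0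
    · rw [mul_zero]
      conv_lhs => rw [← one_mul (ς 0)]
      gcongr
      exact one_le_mul hθ.le hLD1
    · exact hx (pos_iff_ne_zero.2 hx0)
  obtain ⟨a, ha, hau⟩ := (ENNReal.nhds_zero_basis_Iic.eventually_iff).1 e1
  obtain ⟨b, hb, hbu⟩ := (ENNReal.nhds_zero_basis_Iic.eventually_iff).1 (e2.and e4)
  -- The bound `a / L` keeps `L * t` where `ζ ≤ θ * ς`. The three factors `θ` come from `ζ ≤ θ * ς`,
  -- the scaling limit, and `ς ≤ θ * ζ`.
  refine ⟨min b (a / L), lt_min hb (ENNReal.div_pos ha.ne' ENNReal.coe_ne_top), ?_⟩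
  intro t ht s hs
  have hta : L * t ≤ a := by
    rw [mul_comm]
    exact ENNReal.mul_le_of_le_div (ht.trans (min_le_right _ _))
  obtain ⟨k1, k2⟩ := hbu (Set.mem_Iic.2 (ht.trans (min_le_left _ _)))
  calc ζ s ≤ θ * ς s := hau (Set.mem_Iic.2 (hs.trans hta))
    _ ≤ θ * ς (L * t) := by gcongr; exact hmono hs
    _ ≤ θ * (θ * (L : ℝ≥0∞) ^ D * (θ * ζ t)) := by gcongr; exact k2.trans (by gcongr)
    _ = θ ^ 3 * (L : ℝ≥0∞) ^ D * ζ t := by ring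

variable {X Y Z : Type*} [EMetricSpace Y] [EMetricSpace Z]

/-- `g` expands small `f`-distances at most by the factor `L`. -/
def LocallyExpandsBy (L : ℝ≥0) (f : X → Y) (g : X → Z) : Prop :=
  ∃ ε : ℝ≥0∞, 0 < ε ∧ ∀ x y, edist (f x) (f y) ≤ ε → edist (g x) (g y) ≤ L * edist (f x) (f y)

theorem LocallyExpandsBy.eq_of_eq {L : ℝ≥0} {f : X → Y} {g : X → Z}
    (h : LocallyExpandsBy L f g) {x y : X} (hxy : f x = f y) : g x = g y := by
  obtain ⟨ε, _, H⟩ := h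
  have := H x y (by simp [hxy])
  simpa [hxy] using this

theorem LocallyExpandsBy.continuous [TopologicalSpace X] {L : ℝ≥0} {f : X → Y} {g : X → Z}
    (h : LocallyExpandsBy L f g) (hf : Continuous f) : Continuous g := by
  obtain ⟨ε, hε, H⟩ := h
  rw [continuous_iff_continuousAt]
  intro x
  have hfx : Tendsto (fun y => edist (f y) (f x)) (𝓝 x) (𝓝 0) :=
    tendsto_iff_edist_tendsto_0.1 hf.continuousAt
  refine tendsto_iff_edist_tendsto_0.2 ?_
  have hL : Tendsto (fun y => L * edist (f y) (f x)) (𝓝 x) (𝓝 0) := by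
    simpa using ENNReal.Tendsto.const_mul hfx (Or.inr (ENNReal.coe_ne_top (r := L)))
  refine tendsto_of_tendsto_of_tendsto_of_le_of_le' tendsto_const_nhds hL
    (Eventually.of_forall fun _ => zero_le) ?_
  filter_upwards [hfx.eventually (ge_mem_nhds hε)] with y hy using H y x hy

theorem LocallyExpandsBy.of_ell_lt {M₁ M₂ : Type*} [EMetricSpace M₁] [EMetricSpace M₂]
    {f : X → M₁} {g : X → M₂} {L : ℝ≥0}
    (h : ell (pullDist g) (pullFilter g) (pullDist f) (pullFilter f) < L) :
    LocallyExpandsBy L f g := by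
  have := eventually_le_of_ell_lt h
  rw [pullFilter, (ENNReal.nhds_zero_basis_Iic.comap _).eventually_iff] at this
  obtain ⟨ε, hε, H⟩ := this
  exact ⟨ε, hε, fun x y hxy => H (x := (x, y)) hxy⟩

/-- If `g` expands small `f`-distances at most by `L ≥ 1`, then the fractal measure of a `g`-image
is at most `L ^ D` times that of the `f`-image. -/
theorem kMeasure_image_le {D : ℝ} (hD : 0 ≤ D) {ζ : ℝ≥0∞ → ℝ≥0∞}
    (hζ : IsScaleGauge D ζ) {L : ℝ≥0} (hL : 1 ≤ L) {f : X → Y} {g : X → Z}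
    (h : LocallyExpandsBy L f g) (S : Set X) :
    kMeasure ζ (g '' S) ≤ (L : ℝ≥0∞) ^ D * kMeasure ζ (f '' S) := by
  let _ : MeasurableSpace Y := borel Y
  have : BorelSpace Y := ⟨rfl⟩
  let _ : MeasurableSpace Z := borel Z
  have : BorelSpace Z := ⟨rfl⟩
  obtain ⟨ε, hε, H⟩ := h
  have hLD1 : 1 ≤ (L : ℝ≥0∞) ^ D := by
    simpa using ENNReal.rpow_le_rpow (show (1 : ℝ≥0∞) ≤ L by exact_mod_cast hL) hD
  have hLDtop : (L : ℝ≥0∞) ^ D ≠ ∞ := ENNReal.rpow_ne_top_of_nonneg hD ENNReal.coe_ne_top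
  have key : ∀ θ : ℝ≥0∞, 1 < θ → θ ≠ ∞ →
      kMeasure ζ (g '' S) ≤ θ ^ 3 * (L : ℝ≥0∞) ^ D * kMeasure ζ (f '' S) := by
    intro θ hθ hθtop
    have hC0 : θ ^ 3 * (L : ℝ≥0∞) ^ D ≠ 0 :=
      mul_ne_zero (pow_ne_zero _ (zero_lt_one.trans hθ).ne') (zero_lt_one.trans_le hLD1).ne'
    have hCtop : θ ^ 3 * (L : ℝ≥0∞) ^ D ≠ ∞ :=
      ENNReal.mul_ne_top (ENNReal.pow_ne_top hθtop) hLDtop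
    obtain ⟨δ, hδ, hgauge⟩ := hζ.eventually_le hD hL hθ
    rw [kMeasure, kMeasure, OuterMeasure.coe_mkMetric, OuterMeasure.coe_mkMetric,
      Measure.mkMetric_apply, Measure.mkMetric_apply]
    refine iSup₂_le fun r hr => ?_
    -- Covers of mesh `η` satisfy the gauge estimate (`δ`), the expansion bound (`ε`), and still
    -- have mesh at most `r` after expansion by `L`.
    set η : ℝ≥0∞ := min δ (min ε (r / L)) with hη
    have hη0 : 0 < η :=
      lt_min hδ (lt_min hε (ENNReal.div_pos hr.ne' ENNReal.coe_ne_top))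
    refine le_trans ?_ (mul_le_mul_right (le_iSup₂ (f := fun (r : ℝ≥0∞) (_ : 0 < r) =>
        ⨅ (t : ℕ → Set Y) (_ : f '' S ⊆ Set.iUnion t) (_ : ∀ n, Metric.ediam (t n) ≤ r),
          ∑' n, ⨆ _ : (t n).Nonempty, ζ (Metric.ediam (t n))) η hη0) _)
    simp only [ENNReal.mul_iInf_of_ne hC0 hCtop]
    refine le_iInf fun t => le_iInf fun ht => le_iInf fun htη => ?_
    have hdiam : ∀ n, Metric.ediam (g '' (S ∩ f ⁻¹' t n)) ≤ L * Metric.ediam (t n) := by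
      intro n
      refine Metric.ediam_le ?_
      rintro _ ⟨x, hx, rfl⟩ _ ⟨y, hy, rfl⟩
      have hxy : edist (f x) (f y) ≤ Metric.ediam (t n) := Metric.edist_le_ediam_of_mem hx.2 hy.2
      exact (H x y (hxy.trans ((htη n).trans
        ((min_le_right _ _).trans (min_le_left _ _))))).trans (by gcongr)
    refine iInf_le_of_le (fun n => g '' (S ∩ f ⁻¹' t n)) (iInf_le_of_le ?_ (iInf_le_of_le ?_ ?_))
    · rintro _ ⟨x, hx, rfl⟩
      obtain ⟨n, hn⟩ := Set.mem_iUnion.1 (ht ⟨x, hx, rfl⟩)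
      exact Set.mem_iUnion.2 ⟨n, x, ⟨hx, hn⟩, rfl⟩
    · intro n
      refine (hdiam n).trans ?_
      rw [mul_comm]
      exact ENNReal.mul_le_of_le_div
        ((htη n).trans ((min_le_right _ _).trans (min_le_right _ _)))
    · rw [← ENNReal.tsum_mul_left]
      -- Only nonempty sets are counted, so a nonempty transported piece must come from a nonempty
      -- `t n`.
      refine ENNReal.tsum_le_tsum fun n => iSup_le fun hne => ?_
      obtain ⟨_, x, hx, rfl⟩ := hne
      rw [iSup_pos ⟨f x, hx.2⟩]
      exact hgauge _ ((htη n).trans (min_le_left _ _)) _ (hdiam n)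
  have hlim : Tendsto (fun θ : ℝ≥0∞ => θ ^ 3 * ((L : ℝ≥0∞) ^ D * kMeasure ζ (f '' S)))
      (𝓝[>] 1) (𝓝 (1 ^ 3 * ((L : ℝ≥0∞) ^ D * kMeasure ζ (f '' S)))) := by
    refine ENNReal.Tendsto.mul_const ?_ (Or.inl (by simp))
    exact ((ENNReal.continuous_pow 3).tendsto 1).mono_left nhdsWithin_le_nhds
  rw [one_pow, one_mul] at hlim
  have : (𝓝[>] (1 : ℝ≥0∞)).NeBot := nhdsGT_neBot_of_exists_gt ⟨2, by norm_num⟩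
  refine ge_of_tendsto hlim ?_
  filter_upwards [Ioo_mem_nhdsGT (show (1 : ℝ≥0∞) < 2 by norm_num)] with θ hθ
  rw [← mul_assoc]
  exact key θ hθ.1 (hθ.2.trans_le le_top).ne

/-- This is the case `L = 1` in both directions, between `E` and the identity; surjectivity is not
needed. -/
theorem kMeasure_isometry_image {D : ℝ} (hD : 0 ≤ D) {ζ : ℝ≥0∞ → ℝ≥0∞}
    (hζ : IsScaleGauge D ζ) {E : Y → Z} (hE : Isometry E) (S : Set Y) :
    kMeasure ζ (E '' S) = kMeasure ζ S := by
  have h1 := kMeasure_image_le hD hζ le_rfl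
    (f := id) (g := E) ⟨1, one_pos, fun x y _ => by simp [hE x y]⟩ S
  have h2 := kMeasure_image_le hD hζ le_rfl
    (f := E) (g := id) ⟨1, one_pos, fun x y _ => by simp [hE x y]⟩ S
  simp only [ENNReal.coe_one, ENNReal.one_rpow, one_mul, Set.image_id] at h1 h2
  exact le_antisymm h1 h2

/-- Maps at small distance are locally bi-Lipschitz equivalent with a constant close to `1`. -/
theorem eventually_locallyExpandsBy {Υs : ℕ → X → Y} {Υ : X → Z}
    (h : Tendsto (fun k => mapDist (Υs k) Υ) atTop (𝓝 0)) {L : ℝ≥0} (hL : 1 < L) :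
    ∀ᶠ k in atTop, LocallyExpandsBy L Υ (Υs k) ∧ LocallyExpandsBy L (Υs k) Υ := by
  have hpos : (0 : EReal) < ENNReal.log L := by
    rw [ENNReal.zero_lt_log_iff]
    exact_mod_cast hL
  filter_upwards [h.eventually (gt_mem_nhds hpos)] with k hk
  rw [mapDist, logDist, max_lt_iff, ENNReal.log_lt_log_iff, max_lt_iff] at hk
  exact ⟨.of_ell_lt hk.2.1, .of_ell_lt hk.2.2⟩

end Distortion

end PadicFractal

namespace PadicFractal

/-! ### Splitting of `p`-adic balls. -/

section Balls

variable {p : ℕ} [hp : Fact p.Prime]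

/-- The substitution `x = l + p ^ n * y` reduces this to `ℤ_p`, where `j` is the residue of `y`
modulo `p ^ m`. -/
theorem closedBall_eq_iUnion (l : ℚ_[p]) (n : ℤ) (m : ℕ) :
    Metric.closedBall l ((p : ℝ) ^ (-n)) = ⋃ j : Fin (p ^ m),
      Metric.closedBall (l + (p : ℚ_[p]) ^ n * ((j : ℕ) : ℚ_[p])) ((p : ℝ) ^ (-(n + m))) := by
  have hp0 : (p : ℝ) ≠ 0 := by exact_mod_cast hp.out.ne_zero
  have hpos : (0 : ℝ) < (p : ℝ) ^ (-n) := zpow_pos (by exact_mod_cast hp.out.pos) _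
  have hq0 : (p : ℚ_[p]) ≠ 0 := by exact_mod_cast hp.out.ne_zero
  have hscale : ∀ y : ℚ_[p], ‖(p : ℚ_[p]) ^ n * y‖ = (p : ℝ) ^ (-n) * ‖y‖ := fun y => by
    rw [norm_mul, Padic.norm_p_zpow]
  ext x
  obtain ⟨y, hy⟩ : ∃ y : ℚ_[p], x = l + (p : ℚ_[p]) ^ n * y :=
    ⟨(p : ℚ_[p]) ^ (-n) * (x - l), by
      rw [← mul_assoc, ← zpow_add₀ hq0]; simp⟩
  subst hy
  simp only [Metric.mem_closedBall, dist_eq_norm, add_sub_cancel_left, Set.mem_iUnion,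
    add_sub_add_left_eq_sub, ← mul_sub, hscale]
  rw [mul_le_iff_le_one_right hpos]
  have hpow : (p : ℝ) ^ (-(n + m : ℤ)) = (p : ℝ) ^ (-n) * (p : ℝ) ^ (-m : ℤ) := by
    rw [← zpow_add₀ hp0]; congr 1; ring
  simp only [hpow, mul_le_mul_iff_right₀ hpos]
  constructor
  · intro hy
    set z : ℤ_[p] := ⟨y, hy⟩
    refine ⟨⟨z.appr m, z.appr_lt m⟩, ?_⟩
    have := (PadicInt.norm_le_pow_iff_mem_span_pow _ m).2 (PadicInt.appr_spec m z)
    simpa [PadicInt.norm_def] using this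
  · rintro ⟨j, hj⟩
    have h1 : ‖y - ((j : ℕ) : ℚ_[p])‖ ≤ 1 := hj.trans (by
      rw [zpow_neg, zpow_natCast]
      exact inv_le_one_of_one_le₀ (one_le_pow₀ (by exact_mod_cast hp.out.one_le)))
    have h2 : ‖((j : ℕ) : ℚ_[p])‖ ≤ 1 := by simpa using Padic.norm_int_le_one (p := p) (j : ℕ)
    have := Padic.nonarchimedean (p := p) (y - ((j : ℕ) : ℚ_[p])) ((j : ℕ) : ℚ_[p])
    rw [sub_add_cancel] at this
    exact this.trans (max_le h1 h2)

theorem disjoint_closedBall (l : ℚ_[p]) (n : ℤ) (m : ℕ) :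
    Pairwise fun i j : Fin (p ^ m) => Disjoint
      (Metric.closedBall (l + (p : ℚ_[p]) ^ n * ((i : ℕ) : ℚ_[p])) ((p : ℝ) ^ (-(n + m : ℤ))))
      (Metric.closedBall (l + (p : ℚ_[p]) ^ n * ((j : ℕ) : ℚ_[p])) ((p : ℝ) ^ (-(n + m : ℤ)))) := by
  intro i j hij
  have hp0 : (p : ℝ) ≠ 0 := by exact_mod_cast hp.out.ne_zero
  have hpos : (0 : ℝ) < (p : ℝ) ^ (-n) := zpow_pos (by exact_mod_cast hp.out.pos) _
  rcases IsUltrametricDist.closedBall_eq_or_disjoint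
    (l + (p : ℚ_[p]) ^ n * ((i : ℕ) : ℚ_[p])) (l + (p : ℚ_[p]) ^ n * ((j : ℕ) : ℚ_[p]))
    ((p : ℝ) ^ (-(n + m : ℤ))) with h | h
  · exfalso
    have hmem : l + (p : ℚ_[p]) ^ n * ((i : ℕ) : ℚ_[p]) ∈
        Metric.closedBall (l + (p : ℚ_[p]) ^ n * ((j : ℕ) : ℚ_[p])) ((p : ℝ) ^ (-(n + m : ℤ))) := by
      rw [← h]
      exact Metric.mem_closedBall_self (zpow_nonneg (by positivity) _)
    have hpow : (p : ℝ) ^ (-(n + m : ℤ)) = (p : ℝ) ^ (-n) * (p : ℝ) ^ (-m : ℤ) := by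
      rw [← zpow_add₀ hp0]; congr 1; ring
    rw [Metric.mem_closedBall, dist_eq_norm, add_sub_add_left_eq_sub, ← mul_sub, norm_mul,
      Padic.norm_p_zpow, hpow, mul_le_mul_iff_right₀ hpos] at hmem
    have hdvd := (Padic.norm_int_le_pow_iff_dvd (p := p) ((i : ℤ) - (j : ℤ)) m).1
      (by simpa using hmem)
    have hi : (i : ℕ) < p ^ m := i.2
    have hj : (j : ℕ) < p ^ m := j.2
    have := Int.eq_zero_of_abs_lt_dvd hdvd (by
      rw [abs_lt]; zify at hi hj; constructor <;> omega)
    exact hij (Fin.ext (by omega))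
  · exact h

variable {N : ℕ∞}

theorem cball_eq_preimage (l : ℚ_[p]) (n : ℤ) :
    cball (N := N) l n = Subtype.val ⁻¹' Metric.closedBall l ((p : ℝ) ^ (-n)) := by
  ext x
  simp [cball, dist_eq_norm]

theorem cball_eq_iUnion (l : ℚ_[p]) (n : ℤ) (m : ℕ) :
    cball (N := N) l n =
      ⋃ j : Fin (p ^ m), cball (l + (p : ℚ_[p]) ^ n * ((j : ℕ) : ℚ_[p])) (n + m) := by
  simp only [cball_eq_preimage, closedBall_eq_iUnion l n m, Set.preimage_iUnion]

theorem disjoint_cball (l : ℚ_[p]) (n : ℤ) (m : ℕ) :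
    Pairwise fun i j : Fin (p ^ m) => Disjoint
      (cball (N := N) (l + (p : ℚ_[p]) ^ n * ((i : ℕ) : ℚ_[p])) (n + m))
      (cball (l + (p : ℚ_[p]) ^ n * ((j : ℕ) : ℚ_[p])) (n + m)) := by
  intro i j hij
  simp only [cball_eq_preimage]
  exact (disjoint_closedBall l n m hij).preimage _

theorem isClosed_Lam : IsClosed (Lam p N) := by
  simp only [Lam, Set.ofPred_forall]
  exact isClosed_iInter fun k => isClosed_iInter fun _ =>
    isClosed_le continuous_norm continuous_const

theorem isCompact_cball (l : ℚ_[p]) (n : ℤ) : IsCompact (cball (N := N) l n) := by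
  rw [cball_eq_preimage]
  exact isClosed_Lam.isClosedEmbedding_subtypeVal.isCompact_preimage (isCompact_closedBall _ _)

/-- The condition `hn` says that the radius `p ^ (-n)` is at most `p ^ N`; coarser balls would be
truncated by `Λ_N`. -/
theorem mem_Lam_of_norm_sub_le {l x : ℚ_[p]} (hl : l ∈ Lam p N) {n : ℤ}
    (hn : ∀ k : ℕ, N = k → -(k : ℤ) ≤ n) (hx : ‖x - l‖ ≤ (p : ℝ) ^ (-n)) : x ∈ Lam p N := by
  intro k hk
  have h := Padic.nonarchimedean (p := p) (x - l) l
  rw [sub_add_cancel] at h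
  refine h.trans (max_le (hx.trans ?_) (hl k hk))
  rw [← zpow_natCast]
  exact zpow_le_zpow_right₀ (by exact_mod_cast hp.out.one_le) (by linarith [hn k hk])

theorem image_val_cball {l : ℚ_[p]} (hl : l ∈ Lam p N) {n : ℤ}
    (hn : ∀ k : ℕ, N = k → -(k : ℤ) ≤ n) :
    Subtype.val '' cball (N := N) l n = Metric.closedBall l ((p : ℝ) ^ (-n)) := by
  rw [cball_eq_preimage, Subtype.image_preimage_coe, Set.inter_eq_right]
  intro x hx
  exact mem_Lam_of_norm_sub_le hl hn (by simpa [dist_eq_norm] using hx)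

theorem zero_mem_Lam : (0 : ℚ_[p]) ∈ Lam p N := by
  intro k _
  simp

/-- The centres of the balls of level `n + m` in `B_l^n` lie in `Λ_N` if `B_l^n` does. -/
theorem center_mem_Lam {l : ℚ_[p]} (hl : l ∈ Lam p N) {n : ℤ}
    (hn : ∀ k : ℕ, N = k → -(k : ℤ) ≤ n) (j : ℕ) :
    l + (p : ℚ_[p]) ^ n * (j : ℚ_[p]) ∈ Lam p N := by
  refine mem_Lam_of_norm_sub_le hl hn ?_
  rw [add_sub_cancel_left, norm_mul, Padic.norm_p_zpow]
  have : ‖(j : ℚ_[p])‖ ≤ 1 := by simpa using Padic.norm_int_le_one (p := p) j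
  exact mul_le_of_le_one_right (zpow_nonneg (by positivity) _) this

theorem cball_zero_zero : cball (p := p) (N := N) 0 0 = intSet p N := by
  ext x
  simp [cball, intSet]

/-! ### Haar measure of balls and open sets. -/

section Haar

variable [MeasurableSpace ℚ_[p]] [BorelSpace ℚ_[p]]

instance : (haarQp p).IsAddHaarMeasure := by unfold haarQp; infer_instance

instance : (haarQp p).Regular := by unfold haarQp; infer_instance

theorem haarQp_closedBall_zero_one : haarQp p (Metric.closedBall 0 1) = 1 :=
  Measure.addHaarMeasure_self (K₀ := intCompact p)

theorem haarQp_closedBall_eq (l : ℚ_[p]) (r : ℝ) :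
    haarQp p (Metric.closedBall l r) = haarQp p (Metric.closedBall 0 r) :=
  Measure.addHaar_closedBall_center _ _ _

theorem haarQp_closedBall_eq_pow_mul (n : ℤ) (m : ℕ) :
    haarQp p (Metric.closedBall 0 ((p : ℝ) ^ (-n))) =
      (p : ℝ≥0∞) ^ m * haarQp p (Metric.closedBall 0 ((p : ℝ) ^ (-(n + m : ℤ)))) := by
  rw [closedBall_eq_iUnion 0 n m, measure_iUnion (disjoint_closedBall 0 n m)
    (fun _ => measurableSet_closedBall), tsum_fintype]
  simp only [haarQp_closedBall_eq (_ + _), Finset.sum_const, Finset.card_univ, Fintype.card_fin,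
    nsmul_eq_mul, Nat.cast_pow]

/-- An outer measure on `ℚ_p` that is at most `c χ` on the balls of radius at most `1` is at most
`c χ` on all open sets. -/
theorem le_haarQp_of_isOpen {c : ℝ≥0∞} {m : OuterMeasure ℚ_[p]}
    (hm : ∀ (l : ℚ_[p]) (n : ℕ), m (Metric.closedBall l ((p : ℝ) ^ (-(n : ℤ)))) ≤
      c * haarQp p (Metric.closedBall l ((p : ℝ) ^ (-(n : ℤ))))) {U : Set ℚ_[p]} (hU : IsOpen U) :
    m U ≤ c * haarQp p U := by
  classical
  set r : ℕ → ℝ := fun n => (p : ℝ) ^ (-(n : ℤ)) with hr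
  have hr_pos : ∀ n, 0 < r n := fun n => zpow_pos (by exact_mod_cast hp.out.pos) _
  have hr_anti : Antitone r := fun a b hab =>
    zpow_le_zpow_right₀ (by exact_mod_cast hp.out.one_le) (by omega)
  have hex : ∀ x : U, ∃ n, Metric.closedBall (x : ℚ_[p]) (r n) ⊆ U := by
    intro x
    obtain ⟨ε, hε, hεU⟩ := Metric.isOpen_iff.1 hU x x.2
    obtain ⟨n, hn⟩ := exists_pow_lt_of_lt_one hε
      (inv_lt_one_of_one_lt₀ (show (1 : ℝ) < p by exact_mod_cast hp.out.one_lt))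
    refine ⟨n, (Metric.closedBall_subset_ball ?_).trans hεU⟩
    simpa [hr] using hn
  -- The largest ball about `x` of radius at most `1` inside `U`. By the ultrametric inequality such
  -- maximal balls coincide or are disjoint, so they partition `U`.
  let k : U → ℕ := fun x => Nat.find (hex x)
  let B : U → Set ℚ_[p] := fun x => Metric.closedBall (x : ℚ_[p]) (r (k x))
  have hBU : ∀ x, B x ⊆ U := fun x => Nat.find_spec (hex x)
  have hBeq : ∀ x y : U, (y : ℚ_[p]) ∈ B x → B y = B x := by
    intro x y hy
    have hball : ∀ i ≤ k x, Metric.closedBall (y : ℚ_[p]) (r i) = Metric.closedBall (x : ℚ_[p]) (r i) :=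
      fun i hi => (IsUltrametricDist.closedBall_eq_of_mem
        (Metric.closedBall_subset_closedBall (hr_anti hi) hy)).symm
    have hle : k y ≤ k x := Nat.find_min' _ (by rw [hball _ le_rfl]; exact hBU x)
    have hge : k x ≤ k y := Nat.find_min' _ (by rw [← hball _ hle]; exact hBU y)
    have hk : k y = k x := le_antisymm hle hge
    change Metric.closedBall (y : ℚ_[p]) (r (k y)) = _
    rw [hk, hball _ le_rfl]
  have hself : ∀ x : U, (x : ℚ_[p]) ∈ B x := fun x => Metric.mem_closedBall_self (hr_pos _).le
  have hdisj : (Set.range B).Pairwise Disjoint := by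
    rintro _ ⟨x, rfl⟩ _ ⟨y, rfl⟩ hne
    by_contra hnd
    obtain ⟨z, hzx, hzy⟩ := Set.not_disjoint_iff.1 hnd
    exact hne ((hBeq x ⟨z, hBU x hzx⟩ hzx).symm.trans (hBeq y ⟨z, hBU x hzx⟩ hzy))
  have hcount : (Set.range B).Countable := by
    refine Set.PairwiseDisjoint.countable_of_isOpen (s := id) hdisj ?_ ?_
    · rintro _ ⟨x, rfl⟩
      exact IsUltrametricDist.isOpen_closedBall _ (hr_pos _).ne'
    · rintro _ ⟨x, rfl⟩
      exact ⟨x, hself x⟩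
  have hUB : U = ⋃₀ Set.range B := by
    refine Set.Subset.antisymm (fun x hx => ⟨_, ⟨⟨x, hx⟩, rfl⟩, hself ⟨x, hx⟩⟩) ?_
    rintro x ⟨_, ⟨y, rfl⟩, hx⟩
    exact hBU y hx
  have hmeas : ∀ s ∈ Set.range B, MeasurableSet s := by
    rintro _ ⟨x, rfl⟩
    exact measurableSet_closedBall
  have := hcount.to_subtype
  calc m U = m (⋃₀ Set.range B) := by rw [← hUB]
    _ ≤ ∑' s : Set.range B, m s := by
      rw [Set.sUnion_eq_iUnion]
      exact measure_iUnion_le _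
    _ ≤ ∑' s : Set.range B, c * haarQp p s := by
      refine ENNReal.tsum_le_tsum ?_
      rintro ⟨_, x, rfl⟩
      exact hm x (k x)
    _ = c * haarQp p U := by
      rw [ENNReal.tsum_mul_left, ← measure_sUnion hcount hdisj hmeas, ← hUB]

end Haar

end Balls

end PadicFractal

namespace PadicFractal

/-! ### Measures of clusters and of images of arbitrary sets. -/

section Clusters

variable {p : ℕ} [hp : Fact p.Prime] {N : ℕ∞} {d : ℕ} {D : ℝ} {ζ : ℝ≥0∞ → ℝ≥0∞}
  {Υ : Lam p N → EuclideanSpace ℝ (Fin d)}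

/-- The clusters of disjoint balls overlap in null sets. -/
def ClustersAEDisjoint (ζ : ℝ≥0∞ → ℝ≥0∞) (Υ : Lam p N → EuclideanSpace ℝ (Fin d)) : Prop :=
  ∀ (l l' : ℚ_[p]) (n n' : ℤ), Disjoint (cball (N := N) l n) (cball l' n') →
    kMeasure ζ (Υ '' cball l n ∩ Υ '' cball l' n') = 0

theorem kMeasure_iUnion_clusters (hc : Continuous Υ) (hnull : ClustersAEDisjoint ζ Υ)
    {ι : Type*} [Fintype ι] {c : ι → ℚ_[p]} {n : ℤ}
    (hd : Pairwise fun i j => Disjoint (cball (N := N) (c i) n) (cball (c j) n)) :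
    kMeasure ζ (⋃ j, Υ '' cball (c j) n) = ∑ j, kMeasure ζ (Υ '' cball (c j) n) := by
  simp only [ClustersAEDisjoint, kMeasure, OuterMeasure.coe_mkMetric] at hnull ⊢
  rw [measure_iUnion₀, tsum_fintype]
  · exact fun i j hij => hnull _ _ _ _ (hd hij)
  · exact fun j => ((isCompact_cball _ _).image hc).measurableSet.nullMeasurableSet

theorem kMeasure_cluster_eq_sum (hc : Continuous Υ) (hnull : ClustersAEDisjoint ζ Υ)
    (l : ℚ_[p]) (n : ℤ) (m : ℕ) :
    kMeasure ζ (Υ '' cball l n) = ∑ j : Fin (p ^ m),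
      kMeasure ζ (Υ '' cball (l + (p : ℚ_[p]) ^ n * ((j : ℕ) : ℚ_[p])) (n + m)) := by
  rw [← kMeasure_iUnion_clusters hc hnull (disjoint_cball l n m), ← Set.image_iUnion,
    ← cball_eq_iUnion]

/-- The pieces of the cluster about `l` are isometric to those of the cluster about `0`, and both
decompositions are additive. -/
theorem IsAutomodel.kMeasure_cluster_eq (hD : 0 ≤ D) (hζ : IsScaleGauge D ζ)
    (hΥ : IsAutomodel Υ) (hnull : ClustersAEDisjoint ζ Υ) {l : ℚ_[p]} (hl : l ∈ Lam p N) (n : ℤ) :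
    kMeasure ζ (Υ '' cball l n) = kMeasure ζ (Υ '' cball 0 n) := by
  obtain ⟨hc, m, h⟩ := hΥ
  obtain ⟨E, c, hE, hunion, hcl, hdisj⟩ := h n l hl
  rw [hunion, Set.iUnion_congr hcl, kMeasure_iUnion_clusters hc hnull hdisj,
    kMeasure_cluster_eq_sum hc hnull 0 n m]
  refine Finset.sum_congr rfl fun j _ => ?_
  rw [← hcl, kMeasure_isometry_image hD hζ (hE j), zero_add]

/-- Null overlaps are assumed for the limit map only, but the approximants need them too. Points
identified by `Φ` are identified by `Υ`, so overlaps of `Φ`-clusters come from overlaps of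
`Υ`-clusters. -/
theorem ClustersAEDisjoint.of_locallyExpandsBy (hD : 0 ≤ D) (hζ : IsScaleGauge D ζ)
    {L : ℝ≥0} (hL : 1 ≤ L) {Φ : Lam p N → EuclideanSpace ℝ (Fin d)}
    (h₁ : LocallyExpandsBy L Υ Φ) (h₂ : LocallyExpandsBy L Φ Υ)
    (hnull : ClustersAEDisjoint ζ Υ) : ClustersAEDisjoint ζ Φ := by
  intro l l' n n' hd
  set S : Set (Lam p N) := cball l n ∩ Υ ⁻¹' (Υ '' cball l' n')
  have hsub : Φ '' cball l n ∩ Φ '' cball l' n' ⊆ Φ '' S := by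
    rintro _ ⟨⟨x, hx, rfl⟩, y, hy, hxy⟩
    exact ⟨x, ⟨hx, y, hy, h₂.eq_of_eq hxy⟩, rfl⟩
  have hS : kMeasure ζ (Υ '' S) = 0 := by
    rw [Set.image_inter_preimage]
    exact hnull l l' n n' hd
  have := (measure_mono hsub).trans (kMeasure_image_le hD hζ hL h₁ S)
  rw [hS, mul_zero] at this
  exact le_antisymm this zero_le

theorem IsQuasiAutomodel.continuous (hΥ : IsQuasiAutomodel Υ) : Continuous Υ := by
  obtain ⟨Υs, hauto, hlim⟩ := hΥ
  obtain ⟨k, hk⟩ := (eventually_locallyExpandsBy hlim (show (1 : ℝ≥0) < 2 by norm_num)).exists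
  exact hk.2.continuous (hauto k).1

theorem IsQuasiAutomodel.kMeasure_cluster_eq (hD : 0 ≤ D) (hζ : IsScaleGauge D ζ)
    (hΥ : IsQuasiAutomodel Υ) (hnull : ClustersAEDisjoint ζ Υ) {l : ℚ_[p]} (hl : l ∈ Lam p N)
    (n : ℤ) : kMeasure ζ (Υ '' cball l n) = kMeasure ζ (Υ '' cball 0 n) := by
  obtain ⟨Υs, hauto, hlim⟩ := hΥ
  have key : ∀ L : ℝ≥0, 1 < L → ∀ a ∈ Lam p N, ∀ b ∈ Lam p N,
      kMeasure ζ (Υ '' cball a n) ≤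
        (L : ℝ≥0∞) ^ D * ((L : ℝ≥0∞) ^ D * kMeasure ζ (Υ '' cball b n)) := by
    intro L hL a ha b hb
    obtain ⟨k, h₁, h₂⟩ := (eventually_locallyExpandsBy hlim hL).exists
    have hk := hnull.of_locallyExpandsBy hD hζ hL.le h₁ h₂
    calc kMeasure ζ (Υ '' cball a n)
        ≤ (L : ℝ≥0∞) ^ D * kMeasure ζ (Υs k '' cball a n) :=
          kMeasure_image_le hD hζ hL.le h₂ _
      _ = (L : ℝ≥0∞) ^ D * kMeasure ζ (Υs k '' cball b n) := by
          rw [(hauto k).kMeasure_cluster_eq hD hζ hk ha, (hauto k).kMeasure_cluster_eq hD hζ hk hb]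
      _ ≤ _ := by gcongr; exact kMeasure_image_le hD hζ hL.le h₁ _
  have key' : ∀ a ∈ Lam p N, ∀ b ∈ Lam p N,
      kMeasure ζ (Υ '' cball a n) ≤ kMeasure ζ (Υ '' cball b n) := by
    intro a ha b hb
    have hpow : Tendsto (fun L : ℝ≥0 => (L : ℝ≥0∞) ^ D) (𝓝[>] 1) (𝓝 1) := by
      have h1 : Tendsto (fun L : ℝ≥0 => (L : ℝ≥0∞) ^ D) (𝓝 1) (𝓝 (((1 : ℝ≥0) : ℝ≥0∞) ^ D)) :=
        ((ENNReal.continuous_rpow_const (y := D)).comp ENNReal.continuous_coe).tendsto 1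
      rw [ENNReal.coe_one, ENNReal.one_rpow] at h1
      exact h1.mono_left nhdsWithin_le_nhds
    have hl : Tendsto (fun L : ℝ≥0 =>
        (L : ℝ≥0∞) ^ D * ((L : ℝ≥0∞) ^ D * kMeasure ζ (Υ '' cball b n))) (𝓝[>] 1)
        (𝓝 (1 * (1 * kMeasure ζ (Υ '' cball b n)))) := by
      refine ENNReal.Tendsto.mul hpow (Or.inl one_ne_zero)
        (ENNReal.Tendsto.mul_const hpow (Or.inl one_ne_zero)) (Or.inr ENNReal.one_ne_top)
    rw [one_mul, one_mul] at hl
    refine ge_of_tendsto hl ?_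
    filter_upwards [self_mem_nhdsWithin] with L hL
    exact key L hL a ha b hb
  exact le_antisymm (key' _ hl _ zero_mem_Lam) (key' _ zero_mem_Lam _ hl)

/-- A cluster of level `n` has `p ^ m` times the measure of a cluster of level `n + m`. -/
theorem IsQuasiAutomodel.kMeasure_cluster_eq_pow_mul (hD : 0 ≤ D) (hζ : IsScaleGauge D ζ)
    (hΥ : IsQuasiAutomodel Υ) (hnull : ClustersAEDisjoint ζ Υ) {n : ℤ}
    (hn : ∀ k : ℕ, N = k → -(k : ℤ) ≤ n) (m : ℕ) :
    kMeasure ζ (Υ '' cball 0 n) = (p : ℝ≥0∞) ^ m * kMeasure ζ (Υ '' cball 0 (n + m)) := by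
  rw [kMeasure_cluster_eq_sum hΥ.continuous hnull 0 n m, Finset.sum_congr rfl fun (j : Fin (p ^ m)) _ =>
    hΥ.kMeasure_cluster_eq hD hζ hnull (center_mem_Lam zero_mem_Lam hn (j : ℕ)) (n + m)]
  simp

variable [MeasurableSpace ℚ_[p]] [BorelSpace ℚ_[p]]

/-- The measure of a cluster is proportional to the Haar measure of its ball. -/
theorem IsQuasiAutomodel.kMeasure_cluster (hD : 0 ≤ D) (hζ : IsScaleGauge D ζ)
    (hΥ : IsQuasiAutomodel Υ) (hnull : ClustersAEDisjoint ζ Υ) {l : ℚ_[p]} (hl : l ∈ Lam p N)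
    {n : ℤ} (hn : ∀ k : ℕ, N = k → -(k : ℤ) ≤ n) :
    kMeasure ζ (Υ '' cball l n) =
      kMeasure ζ (Υ '' intSet p N) * haarQp p (Metric.closedBall l ((p : ℝ) ^ (-n))) := by
  rw [hΥ.kMeasure_cluster_eq hD hζ hnull hl, haarQp_closedBall_eq, ← cball_zero_zero]
  -- For `n ≥ 0` the unit ball is split down to level `n`; for `n ≤ 0` the ball of level `n` is
  -- split down to level `0`.
  obtain ⟨m, rfl | rfl⟩ := n.eq_nat_or_neg
  · have h1 := hΥ.kMeasure_cluster_eq_pow_mul hD hζ hnull (n := 0) (fun k _ => by omega) m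
    have h2 := haarQp_closedBall_eq_pow_mul (p := p) 0 m
    rw [neg_zero, zpow_zero, haarQp_closedBall_zero_one, zero_add] at h2
    rw [h1, zero_add, mul_right_comm, ← h2, one_mul]
  · have h1 := hΥ.kMeasure_cluster_eq_pow_mul hD hζ hnull hn m
    have h2 := haarQp_closedBall_eq_pow_mul (p := p) (-m) m
    rw [neg_add_cancel] at h1 h2
    rw [neg_zero, zpow_zero, haarQp_closedBall_zero_one, mul_one] at h2
    rw [h1, h2, mul_comm]

/-- The exhausting balls `B_0^{-k}`, including those that are all of `Λ_N`. -/
theorem IsQuasiAutomodel.kMeasure_cluster_zero_neg (hD : 0 ≤ D) (hζ : IsScaleGauge D ζ)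
    (hΥ : IsQuasiAutomodel Υ) (hnull : ClustersAEDisjoint ζ Υ) (k : ℕ) :
    kMeasure ζ (Υ '' cball 0 (-k : ℤ)) = kMeasure ζ (Υ '' intSet p N) *
      haarQp p (Subtype.val '' cball (N := N) 0 (-k : ℤ)) := by
  by_cases hk : ∀ a : ℕ, N = a → -(a : ℤ) ≤ -k
  · rw [image_val_cball zero_mem_Lam hk]
    exact hΥ.kMeasure_cluster hD hζ hnull zero_mem_Lam hk
  · push Not at hk
    obtain ⟨a, ha, hak⟩ := hk
    have huniv : ∀ b : ℕ, a ≤ b → cball (p := p) (N := N) 0 (-b : ℤ) = Set.univ := by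
      refine fun b hb => Set.eq_univ_of_forall fun x => ?_
      have := x.2 a ha
      simp only [cball, Set.mem_ofPred_eq, sub_zero, neg_neg, zpow_natCast]
      exact this.trans (pow_le_pow_right₀ (by exact_mod_cast hp.out.one_le) hb)
    have ha' : ∀ b : ℕ, N = b → -(b : ℤ) ≤ -a := by
      intro b hb
      rw [ha, Nat.cast_inj] at hb
      rw [hb]
    rw [huniv k (by omega), ← huniv a le_rfl, image_val_cball zero_mem_Lam ha']
    exact hΥ.kMeasure_cluster hD hζ hnull zero_mem_Lam ha'

theorem IsQuasiAutomodel.kMeasure_image_le_haar (hD : 0 ≤ D) (hζ : IsScaleGauge D ζ)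
    (hΥ : IsQuasiAutomodel Υ) (hfin : kMeasure ζ (Υ '' intSet p N) < ∞)
    (hnull : ClustersAEDisjoint ζ Υ) (T : Set (Lam p N)) :
    kMeasure ζ (Υ '' T) ≤ kMeasure ζ (Υ '' intSet p N) * haarQp p (Subtype.val '' T) := by
  set c := kMeasure ζ (Υ '' intSet p N)
  -- The fractal measure pulled back along `Υ` is only an outer measure, but subadditivity suffices
  -- for upper bounds.
  set m : OuterMeasure ℚ_[p] :=
    OuterMeasure.map Subtype.val (OuterMeasure.comap Υ (kMeasure ζ)) with hm
  have hm_apply : ∀ S, m S = kMeasure ζ (Υ '' (Subtype.val ⁻¹' S)) := fun S => by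
    simp [hm]
  have hball : ∀ (l : ℚ_[p]) (n : ℕ), m (Metric.closedBall l ((p : ℝ) ^ (-(n : ℤ)))) ≤
      c * haarQp p (Metric.closedBall l ((p : ℝ) ^ (-(n : ℤ)))) := by
    intro l n
    rw [hm_apply, ← cball_eq_preimage]
    have hn : ∀ k : ℕ, N = k → -(k : ℤ) ≤ n := fun k _ => by omega
    rcases (cball (N := N) l n).eq_empty_or_nonempty with he | ⟨x, hx⟩
    · simp [he]
    · have hl : l ∈ Lam p N := mem_Lam_of_norm_sub_le x.2 hn (by rw [norm_sub_rev]; exact hx)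
      exact (hΥ.kMeasure_cluster hD hζ hnull hl hn).le
  -- The factor `c` passes through the infimum over open sets only if nonzero; for `c = 0` the whole
  -- space serves as the open set.
  rcases eq_or_ne c 0 with hc0 | hc0
  · refine (measure_mono (Set.image_mono (Set.subset_univ T))).trans ?_
    have := le_haarQp_of_isOpen hball isOpen_univ
    rw [hm_apply, hc0, zero_mul] at this
    exact this.trans zero_le
  · rw [Set.measure_eq_iInf_isOpen (Subtype.val '' T) (haarQp p)]
    simp only [ENNReal.mul_iInf_of_ne hc0 hfin.ne]
    refine le_iInf fun U => le_iInf fun hTU => le_iInf fun hU => ?_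
    refine le_trans ?_ (le_haarQp_of_isOpen hball hU)
    rw [hm_apply]
    exact measure_mono (Set.image_mono (Set.image_subset_iff.1 hTU))

/-- On the subsets of a ball the pulled back fractal measure dominates the Haar measure. -/
theorem IsQuasiAutomodel.haar_le_kMeasure_image_inter (hD : 0 ≤ D) (hζ : IsScaleGauge D ζ)
    (hΥ : IsQuasiAutomodel Υ) (hfin : kMeasure ζ (Υ '' intSet p N) < ∞)
    (hnull : ClustersAEDisjoint ζ Υ) (T : Set (Lam p N)) (k : ℕ) :
    kMeasure ζ (Υ '' intSet p N) *
        haarQp p (Subtype.val '' (T ∩ cball 0 (-k : ℤ))) ≤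
      kMeasure ζ (Υ '' T) := by
  set c := kMeasure ζ (Υ '' intSet p N)
  set B : Set (Lam p N) := cball 0 (-k : ℤ)
  -- The hull has the same measure as `Υ '' (T ∩ B)`, and its preimage is a measurable set
  -- containing `T ∩ B`.
  set H := toMeasurable (Measure.mkMetric ζ) (Υ '' (T ∩ B))
  have hkH : kMeasure ζ H = kMeasure ζ (Υ '' (T ∩ B)) := by
    simp only [kMeasure, OuterMeasure.coe_mkMetric]
    exact measure_toMeasurable _
  have hHm : MeasurableSet H := measurableSet_toMeasurable _ _
  have hBc : IsCompact B := isCompact_cball _ _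
  have hemb : MeasurableEmbedding (Subtype.val : Lam p N → ℚ_[p]) :=
    MeasurableEmbedding.subtype_coe isClosed_Lam.measurableSet
  have hmeas : ∀ S : Set (Lam p N), MeasurableSet S → MeasurableSet (Subtype.val '' S) :=
    fun S hS => hemb.measurableSet_image.2 hS
  have hPm : MeasurableSet (Υ ⁻¹' H) := hΥ.continuous.measurable hHm
  have hBfin : haarQp p (Subtype.val '' B) < ∞ :=
    (hBc.image continuous_subtype_val).measure_lt_top
  have hsplit : haarQp p (Subtype.val '' (B ∩ Υ ⁻¹' H)) + haarQp p (Subtype.val '' (B \ Υ ⁻¹' H)) =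
      haarQp p (Subtype.val '' B) := by
    have h := measure_inter_add_sdiff (μ := haarQp p) (Subtype.val '' B) (hmeas _ hPm)
    rwa [← Set.image_inter Subtype.val_injective, ← Set.image_sdiff Subtype.val_injective] at h
  have hkB : c * haarQp p (Subtype.val '' B) = kMeasure ζ (Υ '' B) :=
    (hΥ.kMeasure_cluster_zero_neg hD hζ hnull k).symm
  have hdifffin : c * haarQp p (Subtype.val '' (B \ Υ ⁻¹' H)) ≠ ∞ :=
    ENNReal.mul_ne_top hfin.ne
      ((measure_mono (Set.image_mono Set.sdiff_subset)).trans_lt hBfin).ne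
  -- Equality on `B` and the upper bound on `B \ Υ ⁻¹' H` leave at least this much for the
  -- intersection; cancelling requires the finiteness `hdifffin`.
  have hmain : c * haarQp p (Subtype.val '' (B ∩ Υ ⁻¹' H)) ≤ kMeasure ζ (Υ '' (B ∩ Υ ⁻¹' H)) := by
    refine (ENNReal.add_le_add_iff_right hdifffin).1 ?_
    rw [← mul_add, hsplit, hkB]
    calc kMeasure ζ (Υ '' B)
        ≤ kMeasure ζ (Υ '' (B ∩ Υ ⁻¹' H) ∪ Υ '' (B \ Υ ⁻¹' H)) := by
          rw [← Set.image_union, Set.inter_union_sdiff]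
      _ ≤ kMeasure ζ (Υ '' (B ∩ Υ ⁻¹' H)) + kMeasure ζ (Υ '' (B \ Υ ⁻¹' H)) := measure_union_le _ _
      _ ≤ _ := by gcongr; exact hΥ.kMeasure_image_le_haar hD hζ hfin hnull _
  calc c * haarQp p (Subtype.val '' (T ∩ B))
      ≤ c * haarQp p (Subtype.val '' (B ∩ Υ ⁻¹' H)) := by
        refine mul_le_mul_right (measure_mono (Set.image_mono fun x hx => ?_)) _
        exact ⟨hx.2, subset_toMeasurable _ _ ⟨x, hx, rfl⟩⟩
    _ ≤ kMeasure ζ (Υ '' (B ∩ Υ ⁻¹' H)) := hmain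
    _ ≤ kMeasure ζ H := measure_mono (by rintro _ ⟨x, hx, rfl⟩; exact hx.2)
    _ = kMeasure ζ (Υ '' (T ∩ B)) := hkH
    _ ≤ kMeasure ζ (Υ '' T) := measure_mono (Set.image_mono Set.inter_subset_left)

/-- The fractal measure of the image of any set is proportional to its Haar outer measure. -/
theorem IsQuasiAutomodel.kMeasure_image (hD : 0 ≤ D) (hζ : IsScaleGauge D ζ)
    (hΥ : IsQuasiAutomodel Υ) (hfin : kMeasure ζ (Υ '' intSet p N) < ∞)
    (hnull : ClustersAEDisjoint ζ Υ) (T : Set (Lam p N)) :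
    kMeasure ζ (Υ '' T) = kMeasure ζ (Υ '' intSet p N) * haarQp p (Subtype.val '' T) := by
  refine le_antisymm (hΥ.kMeasure_image_le_haar hD hζ hfin hnull T) ?_
  have hp1 : (1 : ℝ) < p := by exact_mod_cast hp.out.one_lt
  have hmono : Monotone fun k : ℕ =>
      (Subtype.val '' (T ∩ cball (N := N) 0 (-k : ℤ)) : Set ℚ_[p]) := by
    refine fun a b hab => Set.image_mono (Set.inter_subset_inter_right _ fun x hx => ?_)
    simp only [cball, Set.mem_ofPred_eq, neg_neg, zpow_natCast] at hx ⊢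
    exact hx.trans (pow_le_pow_right₀ hp1.le hab)
  have hunion : Subtype.val '' T =
      ⋃ k : ℕ, (Subtype.val '' (T ∩ cball (N := N) 0 (-k : ℤ)) : Set ℚ_[p]) := by
    rw [← Set.image_iUnion, ← Set.inter_iUnion, Set.iUnion_eq_univ_iff.2, Set.inter_univ]
    intro x
    obtain ⟨k, hk⟩ := pow_unbounded_of_one_lt ‖(x : ℚ_[p])‖ hp1
    exact ⟨k, by simpa [cball] using hk.le⟩
  -- Continuity from below along increasing unions holds for `χ` on non-measurable sets as well.
  rw [hunion, hmono.measure_iUnion, ENNReal.mul_iSup]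
  exact iSup_le fun k => hΥ.haar_le_kMeasure_image_inter hD hζ hfin hnull T k

end Clusters

end PadicFractal

theorem proposition3 {p : ℕ} [Fact p.Prime] [MeasurableSpace ℚ_[p]] [BorelSpace ℚ_[p]]
    {N : ℕ∞} {d : ℕ} (Υ : PadicFractal.Lam p N → EuclideanSpace ℝ (Fin d))
    (hΥ : PadicFractal.IsQuasiAutomodel Υ)
    (D : ℝ) (hD : 0 ≤ D) (ζ : ℝ≥0∞ → ℝ≥0∞) (hζ : PadicFractal.IsScaleGauge D ζ)
    (hfin : PadicFractal.kMeasure ζ (Υ '' PadicFractal.intSet p N) < ∞)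
    (hnull : ∀ (l l' : ℚ_[p]) (n n' : ℤ),
      Disjoint (PadicFractal.cball (N := N) l n) (PadicFractal.cball l' n') →
        PadicFractal.kMeasure ζ
          (Υ '' PadicFractal.cball l n ∩ Υ '' PadicFractal.cball l' n') = 0) :
    (∀ A : Set (EuclideanSpace ℝ (Fin d)),
      PadicFractal.kMeasure ζ (A ∩ Set.range Υ) =
        PadicFractal.kMeasure ζ (Υ '' PadicFractal.intSet p N) *
          PadicFractal.haarQp p (Subtype.val '' (Υ ⁻¹' A))) ∧
    (PadicFractal.kMeasure ζ (Υ '' PadicFractal.intSet p N) ≠ 0 →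
      ∀ A : Set (EuclideanSpace ℝ (Fin d)),
        (PadicFractal.kMeasure ζ (Υ '' PadicFractal.intSet p N))⁻¹ *
            PadicFractal.kMeasure ζ (A ∩ Set.range Υ) =
          PadicFractal.haarQp p (Subtype.val '' (Υ ⁻¹' A))) := by
  have main : ∀ A : Set (EuclideanSpace ℝ (Fin d)),
      PadicFractal.kMeasure ζ (A ∩ Set.range Υ) =
        PadicFractal.kMeasure ζ (Υ '' PadicFractal.intSet p N) *
          PadicFractal.haarQp p (Subtype.val '' (Υ ⁻¹' A)) := by
    intro A
    rw [← Set.image_preimage_eq_inter_range]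
    exact hΥ.kMeasure_image hD hζ hfin hnull _
  refine ⟨main, fun h0 A => ?_⟩
  rw [main A, ← mul_assoc, ENNReal.inv_mul_cancel h0 hfin.ne, one_mul]
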